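/- A continuum is a nonempty compact connected metric space. An arc is a space homeomorphic to $[0,1]$. A dendrite is a locally connected continuum that contains no simple closed curve, i.e. no subspace homeomorphic to the unit circle $\mathbb S^1$. Let $X$ be a dendrite and let $f\colon X\to X$ be a continuous map. An arc $A\subseteq X$ is called $f$-expanding if there is an integer $n\ge 1$ with $A\subsetneq f^n[A]$, where $f^n$ is the $n$-th iterate of $f$. Let $\operatorname{Per}(f)=\{x\in X : f^n(x)=x \text{ for some integer } n\ge 1\}$. Then the following are equivalent: (e) there is no $f$-expanding arc in $X$; (g) the set $\operatorname{Per}(f)$ is connected (and nonempty). -/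

import Mathlib

/-- A subset `A` of a topological space is an arc if, with the subspace topology, it is
homeomorphic to the unit interval `[0, 1]`. -/
def IsArc {X : Type*} [TopologicalSpace X] (A : Set X) : Prop :=
  Nonempty (A ≃ₜ unitInterval)

/-- A subset `S` of a topological space is a simple closed curve if, with the subspace topology,
it is homeomorphic to the unit circle. -/
def IsSimpleClosedCurve {X : Type*} [TopologicalSpace X] (S : Set X) : Prop :=
  Nonempty (S ≃ₜ Circle)

/-- A continuum is a (nonempty) compact connected metric space. -/
structure IsContinuum (X : Type*) [MetricSpace X] : Prop where
  compact : CompactSpace X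
  connected : ConnectedSpace X

/-- A dendrite is a locally connected continuum that contains no simple closed curve. -/
structure IsDendrite (X : Type*) [MetricSpace X] : Prop extends IsContinuum X where
  locallyConnected : LocallyConnectedSpace X
  no_simpleClosedCurve : ∀ S : Set X, ¬ IsSimpleClosedCurve S

/-- An arc `A` is `f`-expanding if `A` is a proper subset of `f^n[A]` for some positive
integer `n`. -/
def IsExpandingArc {X : Type*} [TopologicalSpace X] (f : X → X) (A : Set X) : Prop :=
  IsArc A ∧ ∃ n : ℕ, 0 < n ∧ A ⊂ f^[n] '' A

/-! In a dendrite, connected sets contain the arcs between their points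
(`ArcMap.mem_of_isPreconnected`): otherwise two different arcs with common ends would produce a
circle. The arcs themselves come from local connectedness, which gives paths as limits of finer and
finer chains; erasing loops then makes the paths injective.

Suppose that no arc is expanding, and let A be the arc between two periodic points and g an iterate
of f fixing both. Then g[A] is connected, hence contains A, hence equals A. If g moved a point of A
towards one end, the subarc from that point to the other end would be expanding. So g fixes A
pointwise and A consists of periodic points. Nonemptiness is the fixed point property
(`exists_fixedPoint`).

Conversely, let Per(f) be connected. If x is not periodic, the component of X∖{x} containing f^n(x)
contains a fixed point of f^n (`exists_fixedPoint_mem_component`), so f^n(x) lies on the same side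
of x as Per(f). If A ⊆ f^n[A] had a non-periodic end, a backward orbit of that end inside A would be
monotone and converge to a periodic point, on the wrong side. So both ends, hence all points of A,
are periodic. Some iterate G with f^n[A] ⊆ G[A] fixes the ends and is injective on Per(f), and
connectedness of A then forbids G[A] from leaving A. -/

namespace Dendrite

open Set Filter Topology Metric Function

/-! ### Locally connected compact spaces are locally path connected -/

/-- A compact locally connected metric space is uniformly locally connected. -/
theorem exists_small_isPreconnected {X : Type*} [MetricSpace X] [CompactSpace X]
    [LocallyConnectedSpace X] {ε : ℝ} (hε : 0 < ε) :
    ∃ δ > 0, ∀ x y : X, dist x y < δ →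
      ∃ C : Set X, IsPreconnected C ∧ x ∈ C ∧ y ∈ C ∧ ∀ z ∈ C, dist x z < ε := by
  obtain ⟨δ, hδ, h⟩ := lebesgue_number_lemma_of_metric (s := (univ : Set X))
    (c := fun x : X => connectedComponentIn (ball x (ε / 2)) x) isCompact_univ
    (fun x => isOpen_ball.connectedComponentIn)
    (fun x _ => mem_iUnion.2 ⟨x, mem_connectedComponentIn (mem_ball_self (half_pos hε))⟩)
  refine ⟨δ, hδ, fun x y hxy => ?_⟩
  obtain ⟨i, hi⟩ := h x (mem_univ x)
  have hx : x ∈ connectedComponentIn (ball i (ε / 2)) i := hi (mem_ball_self hδ)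
  refine ⟨_, isPreconnected_connectedComponentIn, hx, hi (by rwa [mem_ball']), fun z hz => ?_⟩
  have h1 := mem_ball.1 (connectedComponentIn_subset _ _ hx)
  have h2 := mem_ball'.1 (connectedComponentIn_subset _ _ hz)
  linarith [dist_triangle x i z]

/-- Points of a preconnected set are joined by chains with arbitrarily small steps. -/
theorem exists_chain {X : Type*} [MetricSpace X] {C : Set X} (hC : IsPreconnected C) {δ : ℝ}
    (hδ : 0 < δ) {x y : X} (hx : x ∈ C) (hy : y ∈ C) :
    ∃ (n : ℕ) (c : ℕ → X), c 0 = x ∧ (∀ i, n ≤ i → c i = y) ∧ (∀ i, c i ∈ C) ∧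
      ∀ i, dist (c i) (c (i + 1)) < δ := by
  have key : ∀ x ∈ C, ∀ y ∈ C, dist x y < δ → ∃ (n : ℕ) (c : ℕ → X), c 0 = x ∧
      (∀ i, n ≤ i → c i = y) ∧ (∀ i, c i ∈ C) ∧ ∀ i, dist (c i) (c (i + 1)) < δ := by
    intro x hx y hy hxy
    refine ⟨1, fun i => if i = 0 then x else y, by simp, fun i hi => ?_, fun i => ?_, fun i => ?_⟩
    · simp [Nat.one_le_iff_ne_zero.1 hi]
    · dsimp only; split_ifs <;> assumption
    · rcases Nat.eq_zero_or_pos i with rfl | hi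
      · simpa using hxy
      · simpa [hi.ne'] using hδ
  refine IsPreconnected.induction₂' hC (fun x y => ∃ (n : ℕ) (c : ℕ → X), c 0 = x ∧
      (∀ i, n ≤ i → c i = y) ∧ (∀ i, c i ∈ C) ∧ ∀ i, dist (c i) (c (i + 1)) < δ) ?_ ?_ hx hy
  · intro x hx
    filter_upwards [self_mem_nhdsWithin, mem_nhdsWithin_of_mem_nhds (ball_mem_nhds x hδ)]
      with y hy hyx
    exact ⟨key x hx y hy (mem_ball'.1 hyx), key y hy x hx hyx⟩
  · rintro x y z - - - ⟨n, c, hc0, hcn, hcC, hcd⟩ ⟨m, d, hd0, hdm, hdC, hdd⟩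
    refine ⟨n + m, fun i => if i < n then c i else d (i - n), ?_, ?_, ?_, ?_⟩
    · rcases Nat.eq_zero_or_pos n with rfl | hn
      · simp [hd0, ← hc0, hcn 0 le_rfl]
      · simpa [hn] using hc0
    · intro i hi
      simp only [show ¬ i < n by omega, if_false]
      exact hdm _ (by omega)
    · intro i
      dsimp only
      split_ifs
      exacts [hcC _, hdC _]
    · intro i
      by_cases h1 : i + 1 < n
      · simp only [h1, show i < n by omega, if_true]
        exact hcd i
      · by_cases h2 : i < n
        · simp only [h1, h2, if_true, if_false]
          rw [show i + 1 - n = 0 by omega, hd0, ← hcn (i + 1) (by omega)]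
          exact hcd i
        · simp only [h1, h2, if_false]
          rw [show i + 1 - n = (i - n) + 1 by omega]
          exact hdd _

/-- A chain whose consecutive points lie in small connected sets can be refined, uniformly. -/
theorem exists_refined_chain {X : Type*} [MetricSpace X] {ε δ δ' : ℝ} (hδ' : 0 < δ')
    (hε : 0 < ε)
    (hsmall : ∀ x y : X, dist x y < δ →
      ∃ C : Set X, IsPreconnected C ∧ x ∈ C ∧ y ∈ C ∧ ∀ z ∈ C, dist x z < ε)
    {N : ℕ} (hN : 0 < N) {c : ℕ → X} (hconst : ∀ i, N ≤ i → c i = c N)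
    (hstep : ∀ i, dist (c i) (c (i + 1)) < δ) :
    ∃ (M : ℕ) (d : ℕ → X), 0 < M ∧ d 0 = c 0 ∧ (∀ i, N * M ≤ i → d i = c N) ∧
      (∀ i, dist (d i) (d (i + 1)) < δ') ∧ ∀ i, dist (c (i / M)) (d i) < ε := by
  have key : ∀ i, ∃ (n : ℕ) (e : ℕ → X), e 0 = c i ∧ (∀ j, n ≤ j → e j = c (i + 1)) ∧
      (∀ j, dist (c i) (e j) < ε) ∧ ∀ j, dist (e j) (e (j + 1)) < δ' := by
    intro i
    obtain ⟨C, hC, h1, h2, h3⟩ := hsmall _ _ (hstep i)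
    obtain ⟨n, e, he0, hen, heC, hed⟩ := exists_chain hC hδ' h1 h2
    exact ⟨n, e, he0, hen, fun j => h3 _ (heC j), hed⟩
  choose n e he0 hen hee hed using key
  -- One length for all links: each refined link is constant from index `n i` on, so it can be
  -- padded to `M` steps. Index `i` then sits in link `i / M` at position `i % M`.
  set M := (∑ i ∈ Finset.range N, n i) + 1 with hM
  have hMpos : 0 < M := Nat.succ_pos _
  have hnM : ∀ i < N, n i ≤ M := fun i hi =>
    (Finset.single_le_sum (fun _ _ => Nat.zero_le _) (Finset.mem_range.2 hi)).trans (Nat.le_succ _)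
  refine ⟨M, fun i => if i < N * M then e (i / M) (i % M) else c N, hMpos, ?_, ?_, ?_, ?_⟩
  · simp [hN, hMpos, he0]
  · intro i hi
    simp [not_lt.2 hi]
  · intro i
    by_cases h1 : i + 1 < N * M
    · have h2 : i < N * M := by omega
      simp only [h1, h2, if_true]
      by_cases h3 : i % M + 1 < M
      · have h4 : (i + 1) / M = i / M := by
          rw [Nat.div_eq_iff hMpos]
          have := Nat.div_add_mod i M
          rw [mul_comm] at this
          omega
        have h5 : (i + 1) % M = i % M + 1 := by
          have a1 := Nat.div_add_mod i M
          have a2 := Nat.div_add_mod (i + 1) M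
          rw [h4] at a2
          omega
        rw [h4, h5]
        exact hed _ _
      · have h6 : i % M + 1 = M := by have := Nat.mod_lt i hMpos; omega
        have h7 : i + 1 = (i / M + 1) * M := by
          have := Nat.div_add_mod i M
          rw [mul_comm] at this
          rw [add_mul]
          omega
        have h4 : (i + 1) / M = i / M + 1 := by rw [h7, Nat.mul_div_cancel _ hMpos]
        have h5 : (i + 1) % M = 0 := by rw [h7, Nat.mul_mod_left]
        rw [h4, h5, he0, ← hen (i / M) M (hnM _ ((Nat.div_lt_iff_lt_mul hMpos).2 h2))]
        have := hed (i / M) (i % M)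
        rwa [h6] at this
    · by_cases h2 : i < N * M
      · simp only [h1, h2, if_true, if_false]
        have h7 : i + 1 = N * M := by omega
        have hlt := (Nat.div_lt_iff_lt_mul hMpos).2 h2
        have h3 : i / M + 1 = N ∧ i % M + 1 = M := by
          have a1 := Nat.div_add_mod i M
          have a2 := Nat.mod_lt i hMpos
          have a3 : i / M + 1 = N := by
            by_contra hne
            have : i / M + 2 ≤ N := by omega
            have := Nat.mul_le_mul_right M this
            rw [add_mul, mul_comm (i / M)] at this
            omega
          refine ⟨a3, ?_⟩
          rw [← a3, add_mul, mul_comm (i / M)] at h7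
          omega
        have h5 := hed (i / M) (i % M)
        rwa [h3.2, hen (i / M) M (hnM _ hlt), h3.1] at h5
      · simpa [h1, h2] using hδ'
  · intro i
    by_cases h2 : i < N * M
    · simp only [h2, if_true]
      exact hee _ _
    · simp only [h2, if_false]
      rw [hconst _ ((Nat.le_div_iff_mul_le hMpos).2 (by omega))]
      simpa using hε

/-- Close points of a compact locally connected metric space are joined by short paths. -/
theorem exists_small_path {X : Type*} [MetricSpace X] [CompactSpace X]
    [LocallyConnectedSpace X] {ε : ℝ} (hε : 0 < ε) :
    ∃ δ > 0, ∀ x y : X, dist x y < δ →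
      ∃ f : ℝ → X, Continuous f ∧ f 0 = x ∧ f 1 = y ∧ ∀ t, dist x (f t) ≤ 2 * ε := by
  have hεk : ∀ k : ℕ, 0 < ε / 2 / 2 ^ k := fun k => by positivity
  have hδ : ∀ k : ℕ, ∃ δ > 0, δ ≤ ε / 2 / 2 ^ k ∧ ∀ x y : X, dist x y < δ →
      ∃ C : Set X, IsPreconnected C ∧ x ∈ C ∧ y ∈ C ∧ ∀ z ∈ C, dist x z < ε / 2 / 2 ^ k := by
    intro k
    obtain ⟨δ, h0, h1⟩ := exists_small_isPreconnected (X := X) (hεk k)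
    exact ⟨min δ (ε / 2 / 2 ^ k), lt_min h0 (hεk k), min_le_right _ _,
      fun x y h => h1 x y (h.trans_le (min_le_left _ _))⟩
  choose δ hδ0 hδε hδC using hδ
  refine ⟨δ 0, hδ0 0, fun x y hxy => ?_⟩
  let Q : ℕ → ℕ × (ℕ → X) → Prop := fun k s =>
    0 < s.1 ∧ s.2 0 = x ∧ (∀ i, s.1 ≤ i → s.2 i = y) ∧ ∀ i, dist (s.2 i) (s.2 (i + 1)) < δ k
  let R : ℕ → ℕ × (ℕ → X) → ℕ × (ℕ → X) → Prop := fun k s s' =>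
    ∃ M, 0 < M ∧ s'.1 = s.1 * M ∧ ∀ i, dist (s.2 (i / M)) (s'.2 i) < ε / 2 / 2 ^ k
  have hQR : ∀ k s, ∃ s', Q k s → Q (k + 1) s' ∧ R k s s' := by
    intro k s
    by_cases hs : Q k s
    · obtain ⟨hN, h0, hc, hst⟩ := hs
      obtain ⟨M, d, hM, hd0, hdc, hds, hdd⟩ := exists_refined_chain (hδ0 (k + 1)) (hεk k) (hδC k)
        hN (c := s.2) (fun i hi => (hc i hi).trans (hc _ le_rfl).symm) hst
      exact ⟨(s.1 * M, d), fun _ => ⟨⟨Nat.mul_pos hN hM, hd0.trans h0,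
        fun i hi => (hdc i hi).trans (hc _ le_rfl), hds⟩, M, hM, rfl, hdd⟩⟩
    · exact ⟨s, fun h => absurd h hs⟩
  choose F hF using hQR
  let S : ℕ → ℕ × (ℕ → X) := fun k =>
    Nat.rec (1, fun i => if i = 0 then x else y) (fun k s => F k s) k
  have hSs : ∀ k, S (k + 1) = F k (S k) := fun k => rfl
  have hS0 : S 0 = (1, fun i => if i = 0 then x else y) := rfl
  have hSQ : ∀ k, Q k (S k) := by
    intro k
    induction k with
    | zero =>
      refine ⟨Nat.one_pos, by simp [S], fun i hi => ?_, fun i => ?_⟩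
      · rw [hS0] at hi ⊢
        exact if_neg (by dsimp only at hi; omega)
      · rcases Nat.eq_zero_or_pos i with rfl | hi
        · simpa [S] using hxy
        · simpa [S, hi.ne'] using hδ0 0
    | succ k ih => rw [hSs]; exact (hF k _ ih).1
  have hSR : ∀ k, R k (S k) (S (k + 1)) := fun k => by rw [hSs]; exact (hF k _ (hSQ k)).2
  -- Step functions running through the chains at constant speed. Negative times have floor 0 and
  -- give `x`; times beyond 1 give `y`.
  let f : ℕ → ℝ → X := fun k t => (S k).2 ⌊((S k).1 : ℝ) * t⌋₊
  have hfd : ∀ t k, dist (f k t) (f (k + 1) t) ≤ ε / 2 / 2 ^ k := by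
    intro t k
    obtain ⟨M, hM, h1, h2⟩ := hSR k
    -- This is why all links have the same length: at time `t` the refined chain is inside the link
    -- that the coarse chain occupies.
    have h3 : ⌊((S (k + 1)).1 : ℝ) * t⌋₊ / M = ⌊((S k).1 : ℝ) * t⌋₊ := by
      rw [← Nat.floor_div_natCast, h1]
      congr 1
      have : (M : ℝ) ≠ 0 := by positivity
      push_cast
      field_simp
    have := h2 ⌊((S (k + 1)).1 : ℝ) * t⌋₊
    rw [h3] at this
    exact this.le
  have hlim : ∀ t, ∃ a, Tendsto (fun k => f k t) atTop (𝓝 a) := fun t =>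
    cauchySeq_tendsto_of_complete (cauchySeq_of_le_geometric_two (hfd t))
  choose g hg using hlim
  have hfg : ∀ t k, dist (f k t) (g t) ≤ ε / 2 ^ k := fun t k =>
    dist_le_of_le_geometric_two_of_tendsto (hfd t) (hg t) k
  have hconst : ∀ t a, (∀ k, f k t = a) → g t = a := fun t a h =>
    tendsto_nhds_unique (hg t) (by simp [h])
  refine ⟨g, ?_, hconst _ _ fun k => ?_, hconst _ _ fun k => ?_, fun t => ?_⟩
  · rw [Metric.continuous_iff]
    intro t η hη
    obtain ⟨k, hk⟩ : ∃ k : ℕ, 3 * (ε / 2 ^ k) < η := by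
      obtain ⟨k, hk⟩ := exists_pow_lt_of_lt_one (show 0 < η / (3 * ε) by positivity)
        (show (1 / 2 : ℝ) < 1 by norm_num)
      refine ⟨k, ?_⟩
      rw [lt_div_iff₀ (by positivity), one_div, inv_pow] at hk
      rw [div_eq_mul_inv]
      linarith
    have hNpos : (0 : ℝ) < (S k).1 := by exact_mod_cast (hSQ k).1
    -- At such times `f k` takes equal or consecutive values of the chain. The jump and the two
    -- distances to the limit account for the factor 3.
    refine ⟨1 / (S k).1, by positivity, fun s hs => ?_⟩
    have hcl : dist (f k s) (f k t) ≤ ε / 2 ^ k := by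
      have hk1 : ∀ i, dist ((S k).2 i) ((S k).2 (i + 1)) ≤ ε / 2 ^ k := fun i =>
        ((hSQ k).2.2.2 i).le.trans ((hδε k).trans (by gcongr; linarith))
      have hflo : ∀ a b : ℝ, a ≤ b → b < a + 1 → ⌊b⌋₊ = ⌊a⌋₊ ∨ ⌊b⌋₊ = ⌊a⌋₊ + 1 := by
        intro a b hab hba
        have h1 := Nat.floor_le_floor hab
        have h2 : ⌊b⌋₊ < ⌊a⌋₊ + 2 := by
          rcases lt_or_ge b 0 with hb | hb
          · simp [Nat.floor_of_nonpos hb.le]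
          · rw [Nat.floor_lt hb]
            push_cast
            linarith [Nat.lt_floor_add_one a]
        omega
      rw [Real.dist_eq, abs_lt, lt_div_iff₀ hNpos, neg_lt] at hs
      have hs1 := hs.1
      rw [lt_div_iff₀ hNpos] at hs1
      rcases le_total s t with hst | hst
      · rcases hflo ((S k).1 * s) ((S k).1 * t) (by gcongr) (by nlinarith) with h | h
        · simp only [f, h, dist_self]; positivity
        · simp only [f, h]; exact hk1 _
      · rcases hflo ((S k).1 * t) ((S k).1 * s) (by gcongr) (by nlinarith) with h | h
        · simp only [f, h, dist_self]; positivity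
        · simp only [f, h]; rw [dist_comm]; exact hk1 _
    have := dist_triangle4 (g s) (f k s) (f k t) (g t)
    have h1 := hfg s k
    have h2 := hfg t k
    rw [dist_comm] at h1
    linarith
  · simp [f, (hSQ k).2.1]
  · simp only [f, mul_one, Nat.floor_natCast]
    exact (hSQ k).2.2.1 _ le_rfl
  · have h1 := hfg t 0
    have h2 : dist x (f 0 t) ≤ ε := by
      have : f 0 t = x ∨ f 0 t = y := by
        simp only [f, hS0]
        split_ifs <;> simp
      rcases this with h | h
      · rw [h, dist_self]; exact hε.le
      · rw [h]
        have h3 := hδε 0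
        simp only [pow_zero, div_one] at h3
        linarith
    simp only [pow_zero, div_one] at h1
    linarith [dist_triangle x (f 0 t) (g t)]

/-- Open connected subsets of a compact locally connected metric space are path connected. -/
theorem joinedIn_of_isPreconnected {X : Type*} [MetricSpace X] [CompactSpace X]
    [LocallyConnectedSpace X] {U : Set X} (hU : IsOpen U) (hc : IsPreconnected U) {x y : X}
    (hx : x ∈ U) (hy : y ∈ U) : JoinedIn U x y := by
  refine hc.induction₂ (JoinedIn U) (fun x hx => ?_) (fun _ _ _ _ _ _ => JoinedIn.trans)
    (fun _ _ _ _ => JoinedIn.symm) hx hy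
  obtain ⟨r, hr, hrU⟩ := Metric.isOpen_iff.1 hU x hx
  obtain ⟨δ, hδ, h⟩ := exists_small_path (X := X) (show 0 < r / 4 by positivity)
  filter_upwards [mem_nhdsWithin_of_mem_nhds (ball_mem_nhds x hδ)] with y hy
  obtain ⟨f, hf, h0, h1, hf'⟩ := h x y (mem_ball'.1 hy)
  refine JoinedIn.ofLine hf.continuousOn h0 h1 ?_
  rintro _ ⟨t, -, rfl⟩
  exact hrU (mem_ball'.2 (by linarith [hf' t]))

/-! ### Arcs from paths -/

/-- `α` restricted to `[0, 1]` is an injective path from `x` to `y`. -/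
structure ArcMap {X : Type*} [TopologicalSpace X] (α : ℝ → X) (x y : X) : Prop where
  continuous : Continuous α
  injOn : InjOn α (Icc 0 1)
  map_zero : α 0 = x
  map_one : α 1 = y

/-! ### Erasing loops from a path -/

theorem exists_isGreatest_inter_Iic {K : Set ℝ} (hK : IsClosed K) {a t : ℝ} (ha : a ∈ K)
    (hat : a ≤ t) : ∃ m, IsGreatest (K ∩ Iic t) m := by
  have hc : IsCompact (K ∩ Icc a t) := isCompact_Icc.inter_left hK
  have h := hc.isGreatest_sSup ⟨a, ha, le_rfl, hat⟩
  refine ⟨_, ⟨h.1.1, h.1.2.2⟩, fun k hk => ?_⟩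
  rcases le_total a k with hak | hak
  · exact h.2 ⟨hk.1, hak, hk.2⟩
  · exact hak.trans h.1.2.1

theorem exists_isLeast_inter_Ici {K : Set ℝ} (hK : IsClosed K) {b t : ℝ} (hb : b ∈ K)
    (htb : t ≤ b) : ∃ m, IsLeast (K ∩ Ici t) m := by
  have hc : IsCompact (K ∩ Icc t b) := isCompact_Icc.inter_left hK
  have h := hc.isLeast_sInf ⟨b, hb, htb, le_rfl⟩
  refine ⟨_, ⟨h.1.1, h.1.2.1⟩, fun k hk => ?_⟩
  rcases le_total k b with hkb | hkb
  · exact h.2 ⟨hk.1, hk.2, hkb⟩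
  · exact h.1.2.2.trans hkb

/-- The closed sets of times that remain when some loops of the path `γ` are skipped. -/
def LoopErased {X : Type*} (γ : ℝ → X) (K : Set ℝ) : Prop :=
  IsClosed K ∧ K ⊆ Icc 0 1 ∧ (0 : ℝ) ∈ K ∧ (1 : ℝ) ∈ K ∧
    ∀ s ∈ K, ∀ t ∈ K, s < t → Disjoint (Ioo s t) K → γ s = γ t

/-- Zorn's lemma. For a gap (s, t) of the intersection of a chain, compactness gives a member of the
chain missing [s + ε, t - ε]. Its gap there has ends near s and t with equal values of γ, and ε → 0
gives γ s = γ t. -/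
theorem exists_minimal_loopErased {X : Type*} [MetricSpace X] {γ : ℝ → X} (hγ : Continuous γ) :
    ∃ K, Minimal (LoopErased γ) K := by
  refine zorn_superset {K | LoopErased γ K} fun c hc hch => ?_
  rcases c.eq_empty_or_nonempty with rfl | hne
  · refine ⟨Icc 0 1, ⟨isClosed_Icc, subset_rfl, by simp, by simp, fun s hs t ht hst hd => ?_⟩,
      by simp⟩
    exact absurd (show (s + t) / 2 ∈ Icc (0 : ℝ) 1 from
      ⟨by linarith [hs.1, ht.1], by linarith [hs.2, ht.2]⟩)
      (disjoint_left.1 hd ⟨by linarith, by linarith⟩)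
  refine ⟨⋂₀ c, ⟨isClosed_sInter fun K hK => (hc hK).1, ?_, fun K hK => (hc hK).2.2.1,
    fun K hK => (hc hK).2.2.2.1, fun s hs t ht hst hd => ?_⟩, fun K hK => sInter_subset_of_mem hK⟩
  · obtain ⟨K, hK⟩ := hne
    exact (sInter_subset_of_mem hK).trans (hc hK).2.1
  have key : ∀ ε > 0, ε < (t - s) / 2 → ∃ s' ∈ Icc s (s + ε), ∃ t' ∈ Icc (t - ε) t,
      γ s' = γ t' := by
    intro ε hε hεst
    obtain ⟨K, hK, hKd⟩ : ∃ K ∈ c, Disjoint (Icc (s + ε) (t - ε)) K := by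
      by_contra! hcon
      have : Nonempty c := hne.to_subtype
      have hI := IsCompact.nonempty_iInter_of_directed_nonempty_isCompact_isClosed
        (fun K : c => Icc (s + ε) (t - ε) ∩ K.1) ?_ (fun K => not_disjoint_iff_nonempty_inter.1
          (hcon K.1 K.2)) (fun K => isCompact_Icc.inter_right (hc K.2).1)
        (fun K => isClosed_Icc.inter (hc K.2).1)
      · obtain ⟨w, hw⟩ := hI
        rw [mem_iInter] at hw
        have h1 := (hw ⟨_, hne.some_mem⟩).1
        exact disjoint_left.1 hd ⟨by linarith [h1.1], by linarith [h1.2]⟩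
          (mem_sInter.2 fun K hK => (hw ⟨K, hK⟩).2)
      · intro A B
        rcases hch.total A.2 B.2 with h | h
        · exact ⟨A, subset_rfl, inter_subset_inter_right _ h⟩
        · exact ⟨B, inter_subset_inter_right _ h, subset_rfl⟩
    obtain ⟨hKc, hK01, h0, h1, hgap⟩ := hc hK
    have hsK := hs K hK
    have htK := ht K hK
    obtain ⟨m, ⟨hmK, hmt⟩, hm⟩ := exists_isGreatest_inter_Iic hKc hsK
      (show s ≤ (s + t) / 2 by linarith)
    obtain ⟨M, ⟨hMK, hMt⟩, hM⟩ := exists_isLeast_inter_Ici hKc htK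
      (show (s + t) / 2 ≤ t by linarith)
    simp only [mem_Iic, mem_Ici] at hmt hMt
    have hm1 : m < s + ε := by
      by_contra! h
      exact disjoint_left.1 hKd ⟨h, by linarith⟩ hmK
    have hM1 : t - ε < M := by
      by_contra! h
      exact disjoint_left.1 hKd ⟨by linarith, h⟩ hMK
    refine ⟨m, ⟨hm ⟨hsK, by simp only [mem_Iic]; linarith⟩, hm1.le⟩, M,
      ⟨hM1.le, hM ⟨htK, by simp only [mem_Ici]; linarith⟩⟩, hgap m hmK M hMK (by linarith) ?_⟩
    rw [disjoint_left]
    intro w hw hwK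
    rcases le_total w ((s + t) / 2) with h | h
    · exact (hm ⟨hwK, h⟩).not_gt hw.1
    · exact (hM ⟨hwK, h⟩).not_gt hw.2
  refine eq_of_forall_dist_le fun η hη => ?_
  obtain ⟨δ1, hδ1, h1⟩ := Metric.continuous_iff.1 hγ s (η / 2) (half_pos hη)
  obtain ⟨δ2, hδ2, h2⟩ := Metric.continuous_iff.1 hγ t (η / 2) (half_pos hη)
  obtain ⟨ε, hε0, hε⟩ := exists_between (show 0 < min (min δ1 δ2) ((t - s) / 2) from
    lt_min (lt_min hδ1 hδ2) (by linarith))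
  simp only [lt_min_iff] at hε
  obtain ⟨s', hs', t', ht', heq⟩ := key ε hε0 hε.2
  have a1 := h1 s' (by rw [Real.dist_eq, abs_lt]; constructor <;> linarith [hs'.1, hs'.2])
  have a2 := h2 t' (by rw [Real.dist_eq, abs_lt]; constructor <;> linarith [ht'.1, ht'.2])
  rw [heq] at a1
  linarith [dist_triangle_left (γ s) (γ t) (γ t')]

/-- From a path one obtains, by erasing loops, a path with the same endpoints all of whose fibres
are intervals. -/
theorem exists_monotone_path {X : Type*} [MetricSpace X] {γ : ℝ → X} (hγ : Continuous γ) :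
    ∃ σ : ℝ → X, Continuous σ ∧ σ 0 = γ 0 ∧ σ 1 = γ 1 ∧ (∀ t, σ t ∈ γ '' Icc 0 1) ∧
      ∀ s t, s ≤ t → σ s = σ t → ∀ w ∈ Icc s t, σ w = σ s := by
  obtain ⟨K, hKmin⟩ := exists_minimal_loopErased hγ
  obtain ⟨hKc, hK01, h0, h1, hgap⟩ := hKmin.prop
  have hm : ∀ t : Icc (0 : ℝ) 1, ∃ m, IsGreatest (K ∩ Iic t.1) m := fun t =>
    exists_isGreatest_inter_Iic hKc h0 t.2.1
  have hM : ∀ t : Icc (0 : ℝ) 1, ∃ m, IsLeast (K ∩ Ici t.1) m := fun t =>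
    exists_isLeast_inter_Ici hKc h1 t.2.2
  choose m hm using hm
  choose M hM using hM
  have hmle : ∀ t, m t ≤ t.1 := fun t => (hm t).1.2
  have hmM : ∀ t, γ (m t) = γ (M t) := by
    intro t
    rcases ((hm t).1.2.trans (hM t).1.2 : m t ≤ M t).eq_or_lt with h | h
    · rw [h]
    · refine hgap _ (hm t).1.1 _ (hM t).1.1 h (disjoint_left.2 fun w hw hwK => ?_)
      rcases le_total w t with h | h
      · exact ((hm t).2 ⟨hwK, h⟩).not_gt hw.1
      · exact ((hM t).2 ⟨hwK, h⟩).not_gt hw.2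
  have hmfix : ∀ t : Icc (0 : ℝ) 1, t.1 ∈ K → m t = t := fun t ht =>
    le_antisymm (hm t).1.2 ((hm t).2 ⟨ht, le_refl t.1⟩)
  have hMm : ∀ s t : Icc (0 : ℝ) 1, s ≤ t → γ (m s) = γ (m t) ∨
      (s.1 ≤ M s ∧ M s ≤ m t ∧ m t ≤ t.1) := by
    intro s t hst
    by_cases h : (K ∩ Icc s.1 t.1).Nonempty
    · obtain ⟨k, hk, hk1, hk2⟩ := h
      exact Or.inr ⟨(hM s).1.2, ((hM s).2 ⟨hk, hk1⟩).trans ((hm t).2 ⟨hk, hk2⟩), (hm t).1.2⟩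
    · left
      congr 1
      refine le_antisymm ((hm t).2 ⟨(hm s).1.1, (hmle s).trans hst⟩) ((hm s).2 ⟨(hm t).1.1, ?_⟩)
      by_contra hlt
      exact h ⟨m t, (hm t).1.1, (not_le.1 hlt).le, (hm t).1.2⟩
  have hσc : Continuous fun t => γ (m t) := by
    have huc := isCompact_Icc.uniformContinuousOn_of_continuous (hγ.continuousOn (s := Icc 0 1))
    rw [Metric.continuous_iff]
    intro t ε hε
    obtain ⟨δ, hδ, h⟩ := Metric.uniformContinuousOn_iff.1 huc ε hε
    have key : ∀ s t : Icc (0 : ℝ) 1, s ≤ t → t.1 - s.1 < δ → dist (γ (m s)) (γ (m t)) < ε := by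
      intro s t hst hd
      rcases hMm s t hst with h2 | ⟨h2, h3, h4⟩
      · rwa [h2, dist_self]
      -- `m s` may be far to the left of `s`, but `M s` has the same image and lies, with `m t`, in
      -- [s, t].
      · rw [hmM s]
        refine h _ (hK01 (hM s).1.1) _ (hK01 (hm t).1.1) ?_
        rw [Real.dist_eq, abs_lt]
        constructor <;> linarith
    refine ⟨δ, hδ, fun s hs => ?_⟩
    rw [Subtype.dist_eq, Real.dist_eq, abs_lt] at hs
    rcases le_total s t with hst | hst
    · exact key s t hst (by linarith)
    · rw [dist_comm]
      exact key t s hst (by linarith)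
  have hfib : ∀ s t : Icc (0 : ℝ) 1, s ≤ t → γ (m s) = γ (m t) → ∀ w ∈ Icc s t,
      γ (m w) = γ (m s) := by
    intro s t hst heq w hw
    by_cases hne : (K ∩ Icc s.1 t.1).Nonempty
    · obtain ⟨k, hk, hk1, hk2⟩ := hne
      have huv : M s ≤ m t := ((hM s).2 ⟨hk, hk1⟩).trans ((hm t).2 ⟨hk, hk2⟩)
      have hsu : s.1 ≤ M s := (hM s).1.2
      have hvt : m t ≤ t.1 := (hm t).1.2
      have hγuv : γ (M s) = γ (m t) := (hmM s).symm.trans heq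
      -- The loop of γ between `M s` and `m t` can be skipped as well, so by minimality K has no
      -- points strictly between them.
      have hLE : LoopErased γ (K \ Ioo (M s) (m t)) := by
        refine ⟨hKc.sdiff isOpen_Ioo, sdiff_subset.trans hK01, ⟨h0, fun h => ?_⟩,
          ⟨h1, fun h => ?_⟩, fun a ha b hb hab hd => ?_⟩
        · exact (h.1.trans_le' (hK01 (hM s).1.1).1).false
        · exact (h.2.trans_le (hK01 (hm t).1.1).2).false
        · by_cases hd' : Disjoint (Ioo a b) K
          · exact hgap a ha.1 b hb.1 hab hd'
          · obtain ⟨k, hk, hkK⟩ := not_disjoint_iff.1 hd'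
            have hk' : k ∈ Ioo (M s) (m t) := by
              by_contra h
              exact disjoint_left.1 hd hk ⟨hkK, h⟩
            have hau : a = M s := by
              rcases lt_trichotomy a (M s) with h | h | h
              · exact absurd ⟨(hM s).1.1, fun h' => h'.1.false⟩
                  (disjoint_left.1 hd ⟨h, hk'.1.trans hk.2⟩)
              · exact h
              · exact absurd ⟨h, hk.1.trans hk'.2⟩ ha.2
            have hbv : b = m t := by
              rcases lt_trichotomy b (m t) with h | h | h
              · exact absurd ⟨hk'.1.trans hk.2, h⟩ hb.2
              · exact h
              · exact absurd ⟨(hm t).1.1, fun h' => h'.2.false⟩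
                  (disjoint_left.1 hd ⟨hk.1.trans hk'.2, h⟩)
            rw [hau, hbv, hγuv]
      have hKK := hKmin.le_of_le hLE sdiff_subset
      have hno : ∀ k ∈ K, k ∉ Ioo (M s) (m t) := fun k hk => (hKK hk).2
      by_cases h2 : M s ≤ w.1
      · have h3 : M s ≤ m w := (hm w).2 ⟨(hM s).1.1, h2⟩
        have h4 : m w ≤ m t := (hm t).2 ⟨(hm w).1.1, (hmle w).trans hw.2⟩
        rcases h3.eq_or_lt with h5 | h5
        · rw [← h5, hmM]
        · rcases h4.eq_or_lt with h6 | h6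
          · rw [h6, heq]
          · exact absurd ⟨h5, h6⟩ (hno _ (hm w).1.1)
      · congr 1
        refine le_antisymm ((hm s).2 ⟨(hm w).1.1, ?_⟩)
          ((hm w).2 ⟨(hm s).1.1, (hmle s).trans hw.1⟩)
        by_contra h3
        have := (hM s).2 ⟨(hm w).1.1, (lt_of_not_ge h3 : s.1 < m w).le⟩
        exact h2 (this.trans (hm w).1.2)
    · congr 1
      refine le_antisymm ((hm s).2 ⟨(hm w).1.1, ?_⟩)
        ((hm w).2 ⟨(hm s).1.1, (hmle s).trans hw.1⟩)
      by_contra h3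
      exact hne ⟨_, (hm w).1.1, (not_le.1 h3).le, (hmle w).trans hw.2⟩
  refine ⟨fun t => γ (m (projIcc 0 1 zero_le_one t)), hσc.comp continuous_projIcc, ?_, ?_,
    fun t => ⟨_, hK01 (hm _).1.1, rfl⟩, ?_⟩
  · simp only [projIcc_left]
    rw [hmfix ⟨0, _⟩ h0]
  · simp only [projIcc_right]
    rw [hmfix ⟨1, _⟩ h1]
  · intro s t hst heq w hw
    exact hfib _ _ (monotone_projIcc _ hst) heq _
      ⟨monotone_projIcc _ hw.1, monotone_projIcc _ hw.2⟩

/-- A path whose fibres are intervals has the same fibres as some continuous monotone function. -/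
theorem exists_monotone_same_fibres {X : Type*} [MetricSpace X] [CompactSpace X] {σ : ℝ → X}
    (hσ : Continuous σ) (hfib : ∀ s t, s ≤ t → σ s = σ t → ∀ w ∈ Icc s t, σ w = σ s) :
    ∃ Φ : ℝ → ℝ, Continuous Φ ∧ Monotone Φ ∧ ∀ s t, Φ s = Φ t ↔ σ s = σ t := by
  let q : ℕ → ℝ := TopologicalSpace.denseSeq ℝ
  -- Φ is the sum of the `D n` with weights 2⁻ⁿ. For `t < q n` the interval is empty and `D n t =
  -- 0`.
  let D : ℕ → ℝ → ℝ := fun n t => diam (σ '' Icc (q n) t)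
  have hbdd : ∀ s : Set X, Bornology.IsBounded s := fun s =>
    (isCompact_univ.isBounded).subset (subset_univ s)
  have hDmono : ∀ n, Monotone (D n) := fun n s t hst =>
    diam_mono (image_mono (Icc_subset_Icc_right hst)) (hbdd _)
  have hDle : ∀ n s t, s ≤ t → D n t ≤ D n s + diam (σ '' Icc s t) := by
    intro n s t hst
    rcases le_or_gt (q n) s with h | h
    · simp only [D]
      rw [← Icc_union_Icc_eq_Icc h hst, image_union]
      exact diam_union' ⟨σ s, mem_image_of_mem _ ⟨h, le_rfl⟩, mem_image_of_mem _ ⟨le_rfl, hst⟩⟩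
    · exact (diam_mono (image_mono (Icc_subset_Icc_left h.le)) (hbdd _)).trans
        (le_add_of_nonneg_left diam_nonneg)
  have hDc : ∀ n, Continuous (D n) := by
    intro n
    rw [Metric.continuous_iff]
    intro t ε hε
    obtain ⟨δ, hδ, h⟩ := Metric.continuous_iff.1 hσ t (ε / 4) (by positivity)
    have hdiam : ∀ a b, a ≤ b → t - δ < a → b < t + δ → |D n b - D n a| < ε := by
      intro a b hab ha hb
      rw [abs_of_nonneg (sub_nonneg.2 (hDmono n hab))]
      have : diam (σ '' Icc a b) ≤ 2 * (ε / 4) := by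
        refine diam_le_of_subset_closedBall (x := σ t) (by positivity) ?_
        rintro _ ⟨w, hw, rfl⟩
        exact (h w (by rw [Real.dist_eq, abs_lt]; constructor <;> linarith [hw.1, hw.2])).le
      linarith [hDle n a b hab]
    refine ⟨δ, hδ, fun s hs => ?_⟩
    rw [Real.dist_eq, abs_lt] at hs
    rw [Real.dist_eq]
    rcases le_total s t with hst | hst
    · rw [abs_sub_comm]
      exact hdiam s t hst (by linarith) (by linarith)
    · exact hdiam t s hst (by linarith) (by linarith)
  let u : ℕ → ℝ := fun n => (1 / 2) ^ n * diam (univ : Set X)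
  have hu : Summable u := summable_geometric_two.mul_right _
  have hDu : ∀ n t, ‖(1 / 2 : ℝ) ^ n * D n t‖ ≤ u n := by
    intro n t
    rw [Real.norm_of_nonneg (mul_nonneg (by positivity) diam_nonneg)]
    exact mul_le_mul_of_nonneg_left (diam_mono (subset_univ _) (hbdd _)) (by positivity)
  have hsum : ∀ t, Summable fun n => (1 / 2 : ℝ) ^ n * D n t := fun t =>
    Summable.of_norm_bounded hu fun n => hDu n t
  have hle : ∀ {s t : ℝ}, s ≤ t → ∀ n, (1 / 2 : ℝ) ^ n * D n s ≤ (1 / 2 : ℝ) ^ n * D n t :=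
    fun hst n => mul_le_mul_of_nonneg_left (hDmono n hst) (by positivity)
  have heq : ∀ s t, s ≤ t → σ s = σ t → ∀ n, D n s = D n t := by
    intro s t hst h n
    refine le_antisymm (hDmono n hst) ((hDle n s t hst).trans ?_)
    have : diam (σ '' Icc s t) = 0 := by
      refine diam_subsingleton ?_
      rintro _ ⟨a, ha, rfl⟩ _ ⟨b, hb, rfl⟩
      rw [hfib s t hst h a ha, hfib s t hst h b hb]
    rw [this, add_zero]
  have hlt : ∀ s t, s ≤ t → σ s ≠ σ t →
      ∑' n, (1 / 2 : ℝ) ^ n * D n s < ∑' n, (1 / 2 : ℝ) ^ n * D n t := by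
    intro s t hst hne
    have hst' : s < t := hst.lt_of_ne fun h => hne (by rw [h])
    have hopen : IsOpen {w | σ w ≠ σ t} := isOpen_ne.preimage hσ
    obtain ⟨r, hr, hrU⟩ := Metric.isOpen_iff.1 hopen s hne
    -- With `q n` just after `s`, `D n` vanishes at `s`, while at `t` it is at least the distance
    -- from σ (q n) to σ t, which is positive.
    obtain ⟨n, hn⟩ := (TopologicalSpace.denseRange_denseSeq ℝ).exists_mem_open
      isOpen_Ioo (nonempty_Ioo.2 (lt_min hst' (lt_add_of_pos_right s hr)))
    have hn1 : s < q n := hn.1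
    have hn2 : q n < t := hn.2.trans_le (min_le_left _ _)
    have hn3 : q n < s + r := hn.2.trans_le (min_le_right _ _)
    have hqne : σ (q n) ≠ σ t := hrU (by
      rw [mem_ball, Real.dist_eq, abs_lt]; constructor <;> linarith)
    refine (hsum s).tsum_lt_tsum (hle hst) (i := n) ?_ (hsum t)
    refine mul_lt_mul_of_pos_left ?_ (by positivity)
    have h1 : D n s = 0 := by simp [D, Icc_eq_empty_of_lt hn1]
    rw [h1]
    exact (dist_pos.2 hqne).trans_le (dist_le_diam_of_mem (hbdd _)
      (mem_image_of_mem _ ⟨le_rfl, hn2.le⟩) (mem_image_of_mem _ ⟨hn2.le, le_rfl⟩))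
  have hiff : ∀ s t, s ≤ t →
      (∑' n, (1 / 2 : ℝ) ^ n * D n s = ∑' n, (1 / 2 : ℝ) ^ n * D n t ↔ σ s = σ t) := by
    intro s t hst
    refine ⟨fun h => ?_, fun h => ?_⟩
    · by_contra hne
      exact (hlt s t hst hne).ne h
    · exact tsum_congr fun n => by rw [heq s t hst h n]
  refine ⟨fun t => ∑' n, (1 / 2 : ℝ) ^ n * D n t,
    continuous_tsum (fun n => (hDc n).const_mul _) hu hDu,
    fun s t hst => (hsum s).tsum_le_tsum (hle hst) (hsum t), fun s t => ?_⟩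
  rcases le_total s t with hst | hst
  · exact hiff s t hst
  · rw [eq_comm, hiff t s hst, eq_comm]

/-- Two distinct points joined by a path are joined by an arc inside the path. -/
theorem exists_arcMap_of_path {X : Type*} [MetricSpace X] [CompactSpace X] {γ : ℝ → X}
    (hγ : Continuous γ) (hne : γ 0 ≠ γ 1) :
    ∃ α : ℝ → X, ArcMap α (γ 0) (γ 1) ∧ ∀ t, α t ∈ γ '' Icc 0 1 := by
  obtain ⟨σ, hσ, h0, h1, hγσ, hfib⟩ := exists_monotone_path hγ
  obtain ⟨Φ, hΦ, hmono, hiff⟩ := exists_monotone_same_fibres hσ hfib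
  have hlt : Φ 0 < Φ 1 := (hmono zero_le_one).lt_of_ne fun h => by
    rw [hiff, h0, h1] at h
    exact hne h
  have hd : 0 < Φ 1 - Φ 0 := sub_pos.2 hlt
  let Ψ : Icc (0 : ℝ) 1 → Icc (0 : ℝ) 1 := fun t => ⟨(Φ t - Φ 0) / (Φ 1 - Φ 0),
    div_nonneg (sub_nonneg.2 (hmono t.2.1)) hd.le,
    (div_le_one hd).2 (sub_le_sub_right (hmono t.2.2) _)⟩
  have hΨc : Continuous Ψ := by
    refine Continuous.subtype_mk ?_ _
    fun_prop
  have hΨs : Function.Surjective Ψ := by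
    intro u
    obtain ⟨t, ht, htu⟩ := intermediate_value_Icc zero_le_one hΦ.continuousOn
      (show Φ 0 + u * (Φ 1 - Φ 0) ∈ Icc (Φ 0) (Φ 1) from
        ⟨le_add_of_nonneg_right (mul_nonneg u.2.1 hd.le), by nlinarith [u.2.2]⟩)
    refine ⟨⟨t, ht⟩, Subtype.ext ?_⟩
    simp only [Ψ]
    rw [htu, add_sub_cancel_left, mul_div_cancel_right₀ _ hd.ne']
  have hΨi : ∀ s t, Ψ s = Ψ t ↔ σ s = σ t := by
    intro s t
    rw [← hiff, Subtype.ext_iff]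
    simp only [Ψ]
    rw [div_left_inj' hd.ne', sub_left_inj]
  choose τ hτ using hΨs
  have hστ : ∀ t, σ (τ (Ψ t)) = σ t := fun t => (hΨi _ _).1 (hτ _)
  -- The section τ need not be continuous; σ ∘ τ is, because its composite with the quotient map Ψ
  -- is σ.
  have hquot := Topology.IsQuotientMap.of_surjective_continuous (fun u => ⟨τ u, hτ u⟩) hΨc
  have hβ : Continuous fun u => σ (τ u) := by
    rw [hquot.continuous_iff]
    have : (fun u => σ (τ u)) ∘ Ψ = fun t : Icc (0 : ℝ) 1 => σ t := funext hστ
    rw [this]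
    exact hσ.comp continuous_subtype_val
  have hinj : Function.Injective fun u => σ (τ u) := fun u v huv => by
    rw [← hτ u, ← hτ v]
    exact (hΨi _ _).2 huv
  refine ⟨IccExtend zero_le_one fun u => σ (τ u), ⟨hβ.Icc_extend', fun a ha b hb hab => ?_, ?_, ?_⟩,
    fun t => hγσ _⟩
  · rw [IccExtend_of_mem _ _ ha, IccExtend_of_mem _ _ hb] at hab
    exact congrArg Subtype.val (hinj hab)
  · rw [IccExtend_left, ← h0]
    refine Eq.trans ?_ (hστ ⟨0, by simp⟩)
    congr 3
    simp [Ψ]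
  · rw [IccExtend_right, ← h1]
    refine Eq.trans ?_ (hστ ⟨1, by simp⟩)
    congr 3
    simp [Ψ, div_self hd.ne']

theorem exists_arcMap_of_joinedIn {X : Type*} [MetricSpace X] [CompactSpace X] {U : Set X}
    {x y : X} (h : JoinedIn U x y) (hne : x ≠ y) :
    ∃ α : ℝ → X, ArcMap α x y ∧ ∀ t, α t ∈ U := by
  obtain ⟨α, hα, hα'⟩ := exists_arcMap_of_path (γ := h.somePath.extend)
    h.somePath.continuous_extend (by simpa using hne)
  refine ⟨α, by simpa using hα, fun t => ?_⟩
  obtain ⟨s, hs, hst⟩ := hα' t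
  rw [← hst, Path.extend_apply _ hs]
  exact h.somePath_mem _

/-! ### Arcs in dendrites -/

theorem exists_isSimpleClosedCurve_of_loop {X : Type*} [MetricSpace X] {f : ℝ → X}
    (hf : ContinuousOn f (Icc 0 1)) (h01 : f 0 = f 1) (hinj : InjOn f (Ico 0 1)) :
    ∃ S : Set X, IsSimpleClosedCurve S := by
  have : Fact (0 < (1 : ℝ)) := ⟨one_pos⟩
  have hc : Continuous (AddCircle.liftIco (1 : ℝ) 0 f) :=
    AddCircle.liftIco_continuous (by simpa using h01) (by simpa using hf)
  have hi : Function.Injective (AddCircle.liftIco (1 : ℝ) 0 f) := by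
    intro a b hab
    obtain ⟨s, hs, rfl⟩ : a ∈ ((↑) : ℝ → AddCircle (1 : ℝ)) '' Ico 0 (0 + 1) := by
      rw [AddCircle.coe_image_Ico_eq]; trivial
    obtain ⟨t, ht, rfl⟩ : b ∈ ((↑) : ℝ → AddCircle (1 : ℝ)) '' Ico 0 (0 + 1) := by
      rw [AddCircle.coe_image_Ico_eq]; trivial
    rw [AddCircle.liftIco_coe_apply hs, AddCircle.liftIco_coe_apply ht] at hab
    rw [zero_add] at hs ht
    rw [hinj hs ht hab]
  exact ⟨_, ⟨(hc.isClosedEmbedding hi).isEmbedding.toHomeomorph.symm.trans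
    (AddCircle.homeomorphCircle one_ne_zero)⟩⟩

theorem affine_mem_Icc {s t r : ℝ} (hst : s ≤ t) (hr : r ∈ Icc (0 : ℝ) 1) :
    s + r * (t - s) ∈ Icc s t :=
  ⟨le_add_of_nonneg_right (mul_nonneg hr.1 (sub_nonneg.2 hst)), by nlinarith [hr.2]⟩

/-- Two arcs with common endpoints and different images yield a simple closed curve. -/
theorem ArcMap.exists_isSimpleClosedCurve {X : Type*} [MetricSpace X] {α β : ℝ → X} {x y : X}
    (hα : ArcMap α x y) (hβ : ArcMap β x y) {t₀ : ℝ} (ht₀ : t₀ ∈ Icc (0 : ℝ) 1)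
    (h : α t₀ ∉ β '' Icc 0 1) : ∃ S : Set X, IsSimpleClosedCurve S := by
  have hK : IsClosed (α ⁻¹' (β '' Icc 0 1)) :=
    (isCompact_Icc.image hβ.continuous).isClosed.preimage hα.continuous
  have h0 : (0 : ℝ) ∈ α ⁻¹' (β '' Icc 0 1) := ⟨0, by simp, by rw [hα.map_zero, hβ.map_zero]⟩
  have h1 : (1 : ℝ) ∈ α ⁻¹' (β '' Icc 0 1) := ⟨1, by simp, by rw [hα.map_one, hβ.map_one]⟩
  obtain ⟨s, ⟨hsK, hst⟩, hs⟩ := exists_isGreatest_inter_Iic hK h0 ht₀.1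
  obtain ⟨t, ⟨htK, htt⟩, ht⟩ := exists_isLeast_inter_Ici hK h1 ht₀.2
  have hs0 : s < t₀ := lt_of_le_of_ne hst fun h' => h (h' ▸ hsK)
  have ht0 : t₀ < t := lt_of_le_of_ne htt fun h' => h (h' ▸ htK)
  have hlt : s < t := hs0.trans ht0
  have hs01 : 0 ≤ s := hs ⟨h0, ht₀.1⟩
  have ht01 : t ≤ 1 := ht ⟨h1, ht₀.2⟩
  have hends : ∀ w ∈ Icc s t, α w ∈ β '' Icc 0 1 → w = s ∨ w = t := by
    intro w hw hwK
    rcases le_total w t₀ with h' | h'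
    · exact Or.inl (le_antisymm (hs ⟨hwK, h'⟩) hw.1)
    · exact Or.inr (le_antisymm hw.2 (ht ⟨hwK, h'⟩))
  have hαi : ∀ a ∈ Icc s t, ∀ b ∈ Icc s t, α a = α b → a = b := fun a ha b hb hab =>
    hα.injOn ⟨hs01.trans ha.1, ha.2.trans ht01⟩ ⟨hs01.trans hb.1, hb.2.trans ht01⟩ hab
  obtain ⟨u, hu, hus⟩ := hsK
  obtain ⟨v, hv, hvt⟩ := htK
  have huv : u ≠ v := fun h' => hlt.ne (hαi s ⟨le_rfl, hlt.le⟩ t ⟨hlt.le, le_rfl⟩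
    (by rw [← hus, ← hvt, h']))
  -- The loop follows α from `s` to `t`, then β from `v` back to `u`. Either order of `u` and `v` is
  -- allowed.
  let A : ℝ → ℝ := fun r => s + 2 * r * (t - s)
  let B : ℝ → ℝ := fun r => v + (2 * r - 1) * (u - v)
  have hA : ∀ r, 0 ≤ r → r ≤ 1 / 2 → A r ∈ Icc s t := fun r h0 h1 =>
    affine_mem_Icc hlt.le ⟨by linarith, by linarith⟩
  have hB : ∀ r, 1 / 2 ≤ r → r ≤ 1 → B r ∈ Icc 0 1 := by
    intro r h0 h1
    have : B r = (2 * r - 1) * u + (2 - 2 * r) * v := by simp only [B]; ring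
    rw [this]
    have ha : 0 ≤ 2 * r - 1 := by linarith
    have hb : 0 ≤ 2 - 2 * r := by linarith
    exact ⟨add_nonneg (mul_nonneg ha hu.1) (mul_nonneg hb hv.1), by nlinarith [hu.2, hv.2]⟩
  refine exists_isSimpleClosedCurve_of_loop
    (f := fun r => if r ≤ 1 / 2 then α (A r) else β (B r)) (Continuous.continuousOn ?_) ?_ ?_
  · refine Continuous.if_le ?_ ?_ continuous_id continuous_const ?_
    · exact hα.continuous.comp (by fun_prop)
    · exact hβ.continuous.comp (by fun_prop)
    · rintro r rfl
      have e1 : A (1 / 2) = t := by simp only [A]; ring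
      have e2 : B (1 / 2) = v := by simp only [B]; ring
      simp only [e1, e2, hvt]
  · have e1 : A 0 = s := by simp only [A]; ring
    have e2 : B 1 = u := by simp only [B]; ring
    norm_num [e1, e2, hus]
  · have hcross : ∀ a b, 0 ≤ a → a ≤ 1 / 2 → 1 / 2 < b → b < 1 → α (A a) ≠ β (B b) := by
      intro a b ha0 ha hb hb1 hab
      rcases hends _ (hA a ha0 ha) ⟨_, hB b hb.le hb1.le, hab.symm⟩ with h' | h'
      · rw [h', ← hus] at hab
        have h2 := hβ.injOn hu (hB b hb.le hb1.le) hab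
        have h3 : (u - v) * (2 - 2 * b) = 0 := by simp only [B] at h2; linear_combination h2
        rcases mul_eq_zero.1 h3 with h4 | h4
        · exact huv (by linarith)
        · linarith
      · rw [h', ← hvt] at hab
        have h2 := hβ.injOn hv (hB b hb.le hb1.le) hab
        have h3 : (u - v) * (2 * b - 1) = 0 := by simp only [B] at h2; linear_combination -h2
        rcases mul_eq_zero.1 h3 with h4 | h4
        · exact huv (by linarith)
        · linarith
    intro a ha b hb hab
    dsimp only at hab
    split_ifs at hab with h1 h2 h2
    · have h3 := hαi _ (hA a ha.1 h1) _ (hA b hb.1 h2) hab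
      simp only [A] at h3
      have h4 : (t - s) * (a - b) = 0 := by linear_combination h3 / 2
      rcases mul_eq_zero.1 h4 with h5 | h5 <;> linarith
    · exact absurd hab (hcross a b ha.1 h1 (not_le.1 h2) hb.2)
    · exact absurd hab.symm (hcross b a hb.1 h2 (not_le.1 h1) ha.2)
    · have h3 := hβ.injOn (hB a (not_le.1 h1).le ha.2.le) (hB b (not_le.1 h2).le hb.2.le) hab
      simp only [B] at h3
      have h4 : (u - v) * (a - b) = 0 := by linear_combination h3 / 2
      rcases mul_eq_zero.1 h4 with h5 | h5
      · exact absurd (by linarith) huv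
      · linarith

theorem ArcMap.subarc {X : Type*} [MetricSpace X] {α : ℝ → X} {x y : X} (hα : ArcMap α x y)
    {s t : ℝ} (hs : 0 ≤ s) (hst : s < t) (ht : t ≤ 1) :
    ArcMap (fun r => α (s + r * (t - s))) (α s) (α t) where
  continuous := hα.continuous.comp (by fun_prop)
  injOn := by
    intro a ha b hb hab
    have h1 := affine_mem_Icc hst.le ha
    have h2 := affine_mem_Icc hst.le hb
    have h3 := hα.injOn ⟨hs.trans h1.1, h1.2.trans ht⟩ ⟨hs.trans h2.1, h2.2.trans ht⟩ hab
    have h4 : (t - s) * (a - b) = 0 := by linear_combination h3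
    rcases mul_eq_zero.1 h4 with h5 | h5 <;> linarith
  map_zero := by simp
  map_one := by simp

theorem ArcMap.isArc_image {X : Type*} [MetricSpace X] {α : ℝ → X} {x y : X} (hα : ArcMap α x y) :
    IsArc (α '' Icc 0 1) := by
  have hc : Continuous fun t : Icc (0 : ℝ) 1 => α t := hα.continuous.comp continuous_subtype_val
  have hi : Function.Injective fun t : Icc (0 : ℝ) 1 => α t := fun a b hab =>
    Subtype.ext (hα.injOn a.2 b.2 hab)
  have hr : range (fun t : Icc (0 : ℝ) 1 => α t) = α '' Icc 0 1 := by
    rw [image_eq_range]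
  rw [← hr]
  exact ⟨(hc.isClosedEmbedding hi).isEmbedding.toHomeomorph.symm⟩

theorem ArcMap.isArc_image_Icc {X : Type*} [MetricSpace X] {α : ℝ → X} {x y : X}
    (hα : ArcMap α x y) {s t : ℝ} (hs : 0 ≤ s) (hst : s < t) (ht : t ≤ 1) :
    IsArc (α '' Icc s t) := by
  have h := (hα.subarc hs hst ht).isArc_image
  have h2 : (fun r => s + r * (t - s)) '' Icc 0 1 = Icc s t := by
    ext w
    constructor
    · rintro ⟨r, hr, rfl⟩
      exact affine_mem_Icc hst.le hr
    · intro hw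
      have hd : 0 < t - s := sub_pos.2 hst
      exact ⟨(w - s) / (t - s), ⟨div_nonneg (sub_nonneg.2 hw.1) hd.le,
        (div_le_one hd).2 (by linarith [hw.2])⟩, by field_simp; ring⟩
  rwa [← h2, image_image]

theorem exists_arcMap_of_isArc {X : Type*} [MetricSpace X] {A : Set X} (hA : IsArc A) :
    ∃ (α : ℝ → X) (x y : X), ArcMap α x y ∧ α '' Icc 0 1 = A := by
  obtain ⟨e⟩ := hA
  refine ⟨IccExtend (zero_le_one' ℝ) fun t => (e.symm t : X), _, _,
    ⟨(continuous_subtype_val.comp e.symm.continuous).Icc_extend', ?_, rfl, rfl⟩, ?_⟩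
  · intro a ha b hb hab
    rw [IccExtend_of_mem _ _ ha, IccExtend_of_mem _ _ hb] at hab
    exact congrArg Subtype.val (e.symm.injective (Subtype.ext hab))
  · ext z
    constructor
    · rintro ⟨t, ht, rfl⟩
      rw [IccExtend_of_mem _ _ ht]
      exact (e.symm _).2
    · intro hz
      refine ⟨e ⟨z, hz⟩, (e ⟨z, hz⟩).2, ?_⟩
      rw [IccExtend_of_mem _ _ (e ⟨z, hz⟩).2]
      simp

theorem exists_arcMap {X : Type*} [MetricSpace X] (hX : IsDendrite X) {U : Set X} (hU : IsOpen U) (hUc : IsPreconnected U) {x y : X}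
    (hx : x ∈ U) (hy : y ∈ U) (hne : x ≠ y) : ∃ α : ℝ → X, ArcMap α x y ∧ ∀ t, α t ∈ U := by
  have := hX.compact
  have := hX.locallyConnected
  exact exists_arcMap_of_joinedIn (joinedIn_of_isPreconnected hU hUc hx hy) hne

/-- In a dendrite, a connected set contains the arc between any two of its points. -/
theorem ArcMap.mem_of_isPreconnected {X : Type*} [MetricSpace X] (hX : IsDendrite X)
    {α : ℝ → X} {x y : X} (hα : ArcMap α x y) {C : Set X} (hC : IsPreconnected C) {s t u : ℝ}
    (hs : 0 ≤ s) (hst : s ≤ t) (htu : t ≤ u) (hu : u ≤ 1) (hsC : α s ∈ C) (huC : α u ∈ C) :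
    α t ∈ C := by
  have := hX.locallyConnected
  by_contra hz
  have hst' : s < t := hst.lt_of_ne fun h => hz (h ▸ hsC)
  have htu' : t < u := htu.lt_of_ne fun h => hz (h ▸ huC)
  have hαsu := hα.subarc hs (hst'.trans htu') hu
  have hUsub : connectedComponentIn {α t}ᶜ (α s) ⊆ {α t}ᶜ := connectedComponentIn_subset _ _
  -- This component is open and connected, so it contains an arc from α s to α u avoiding α t, which
  -- together with α gives a circle.
  have hCsub : C ⊆ connectedComponentIn {α t}ᶜ (α s) :=
    hC.subset_connectedComponentIn hsC fun c hc h => hz (mem_singleton_iff.1 h ▸ hc)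
  obtain ⟨β, hβ, hβU⟩ := exists_arcMap hX isOpen_compl_singleton.connectedComponentIn
    isPreconnected_connectedComponentIn (hCsub hsC) (hCsub huC) fun h =>
      (hst'.trans htu').ne (hα.injOn ⟨hs, by linarith⟩ ⟨by linarith, hu⟩ h)
  have hd : 0 < u - s := by linarith
  obtain ⟨S, hS⟩ := hαsu.exists_isSimpleClosedCurve hβ (t₀ := (t - s) / (u - s))
    ⟨div_nonneg (by linarith) hd.le, (div_le_one hd).2 (by linarith)⟩ (by
      rw [div_mul_cancel₀ _ hd.ne', add_sub_cancel]
      rintro ⟨r, -, hr⟩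
      exact hUsub (hβU r) hr)
  exact hX.no_simpleClosedCurve S hS

theorem exists_arcMap_univ {X : Type*} [MetricSpace X] (hX : IsDendrite X) {x y : X}
    (hne : x ≠ y) : ∃ α : ℝ → X, ArcMap α x y := by
  have := hX.connected
  obtain ⟨α, hα, -⟩ := exists_arcMap hX isOpen_univ isPreconnected_univ (mem_univ x) (mem_univ y)
    hne
  exact ⟨α, hα⟩

/-! ### The fixed point property -/

/-- `x` lies between `p` and `y`: every connected set containing `p` and `y` contains `x`. -/
def Between {X : Type*} [TopologicalSpace X] (p x y : X) : Prop :=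
  ∀ C : Set X, IsPreconnected C → p ∈ C → y ∈ C → x ∈ C

theorem Between.trans {X : Type*} [TopologicalSpace X] {p x y z : X} (h₁ : Between p x y)
    (h₂ : Between p y z) : Between p x z :=
  fun C hC hp hz => h₁ C hC hp (h₂ C hC hp hz)

theorem exists_compact_joining {X : Type*} [MetricSpace X] (hX : IsDendrite X) {C : Set X}
    (hC : IsPreconnected C) {p y : X} (hp : p ∈ C) (hy : y ∈ C) :
    ∃ K ⊆ C, IsCompact K ∧ IsPreconnected K ∧ p ∈ K ∧ y ∈ K := by
  by_cases hne : p = y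
  · subst hne
    exact ⟨{p}, singleton_subset_iff.2 hp, isCompact_singleton, isPreconnected_singleton, rfl, rfl⟩
  · obtain ⟨α, hα⟩ := exists_arcMap_univ hX hne
    refine ⟨α '' Icc 0 1, ?_, isCompact_Icc.image hα.continuous,
      isPreconnected_Icc.image _ hα.continuous.continuousOn, ⟨0, by simp, hα.map_zero⟩,
      ⟨1, by simp, hα.map_one⟩⟩
    rintro _ ⟨t, ht, rfl⟩
    exact hα.mem_of_isPreconnected hX hC le_rfl ht.1 ht.2 le_rfl (by rwa [hα.map_zero])
      (by rwa [hα.map_one])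

theorem Between.antisymm {X : Type*} [MetricSpace X] (hX : IsDendrite X) {p x y : X}
    (h₁ : Between p x y) (h₂ : Between p y x) : x = y := by
  by_cases hpy : p = y
  · subst hpy
    exact h₁ {p} isPreconnected_singleton rfl rfl
  obtain ⟨β, hβ⟩ := exists_arcMap_univ hX hpy
  have hconn : ∀ s, IsPreconnected (β '' Icc 0 s) := fun s =>
    isPreconnected_Icc.image _ hβ.continuous.continuousOn
  obtain ⟨s, hs, rfl⟩ := h₁ _ (hconn 1) ⟨0, by simp, hβ.map_zero⟩ ⟨1, by simp, hβ.map_one⟩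
  obtain ⟨r, hr, hry⟩ := h₂ _ (hconn s) ⟨0, ⟨le_rfl, hs.1⟩, hβ.map_zero⟩ ⟨s, ⟨hs.1, le_rfl⟩, rfl⟩
  have h1 : r = 1 := hβ.injOn ⟨hr.1, hr.2.trans hs.2⟩ (by simp) (by rw [hry, hβ.map_one])
  rw [le_antisymm hs.2 (h1 ▸ hr.2), hβ.map_one]

/-- Small connected open neighbourhoods in a locally connected space. -/
theorem exists_isOpen_isPreconnected {X : Type*} [TopologicalSpace X] [LocallyConnectedSpace X]
    {U : Set X} (hU : IsOpen U) {x : X} (hx : x ∈ U) :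
    ∃ V ⊆ U, IsOpen V ∧ IsPreconnected V ∧ x ∈ V :=
  ⟨connectedComponentIn U x, connectedComponentIn_subset _ _, hU.connectedComponentIn,
    isPreconnected_connectedComponentIn, mem_connectedComponentIn hx⟩

/-- Failure of betweenness is stable: a compact connected set joining `p` to `y` and missing `x`
still misses nearby points, and adding a small connected neighbourhood of `y` reaches all points
near `y`. -/
theorem isClosed_between {X : Type*} [MetricSpace X] (hX : IsDendrite X) (p : X) :
    IsClosed {q : X × X | Between p q.1 q.2} := by
  have := hX.locallyConnected
  rw [← isOpen_compl_iff, isOpen_iff_mem_nhds]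
  rintro ⟨x, y⟩ hxy
  simp only [mem_compl_iff, mem_ofPred_eq, Between] at hxy
  push Not at hxy
  obtain ⟨C, hC, hp, hy, hx⟩ := hxy
  obtain ⟨K, hKC, hK, hKc, hpK, hyK⟩ := exists_compact_joining hX hC hp hy
  obtain ⟨U, W, hU, hW, hxU, hyW, hUW⟩ := t2_separation (show x ≠ y from fun h => hx (h ▸ hy))
  obtain ⟨V, hVW, hV, hVc, hyV⟩ := exists_isOpen_isPreconnected hW hyW
  filter_upwards [(prod_mem_nhds ((hU.inter hK.isClosed.isOpen_compl).mem_nhds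
    ⟨hxU, fun h => hx (hKC h)⟩) (hV.mem_nhds hyV))]
  rintro ⟨a, b⟩ ⟨⟨haU, haK⟩, hbV⟩ hab
  rcases hab (K ∪ V) (hKc.union y hyK hyV hVc) (Or.inl hpK) (Or.inr hbV) with h | h
  · exact haK h
  · exact disjoint_left.1 hUW haU (hVW h)

/-- Dendrites have the fixed point property. -/
theorem exists_fixedPoint {X : Type*} [MetricSpace X] (hX : IsDendrite X) {g : X → X}
    (hg : Continuous g) : ∃ x, g x = x := by
  have := hX.compact
  have := hX.connected
  have := hX.locallyConnected
  obtain ⟨p⟩ : Nonempty X := inferInstance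
  let S := {z : X // Between p z (g z)}
  have hcl := isClosed_between hX p
  have hchain : ∀ c : Set S, IsChain (fun a b : S => Between p a.1 b.1) c →
      ∃ ub : S, ∀ a ∈ c, Between p a.1 ub.1 := by
    intro c hc
    rcases c.eq_empty_or_nonempty with rfl | hne
    · exact ⟨⟨p, fun _ _ h _ => h⟩, by simp⟩
    have : Nonempty c := hne.to_subtype
    -- Upper bounds of `a` within S. These sets are compact and directed, so a common point bounds
    -- the chain.
    let T : c → Set X := fun a => {z | Between p z (g z)} ∩ {z | Between p a.1.1 z}
    have hT : ∀ a, IsClosed (T a) := fun a =>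
      (hcl.preimage (continuous_id.prodMk hg)).inter
        (hcl.preimage (continuous_const.prodMk continuous_id))
    obtain ⟨z, hz⟩ := IsCompact.nonempty_iInter_of_directed_nonempty_isCompact_isClosed T
      (fun a b => by
        by_cases hab : a = b
        · exact ⟨a, subset_rfl, by rw [hab]⟩
        rcases hc a.2 b.2 (fun h => hab (Subtype.ext h)) with h | h
        · exact ⟨b, fun z hz => ⟨hz.1, Between.trans h hz.2⟩, subset_rfl⟩
        · exact ⟨a, subset_rfl, fun z hz => ⟨hz.1, Between.trans h hz.2⟩⟩)
      (fun a => ⟨a.1.1, a.1.2, fun _ _ _ h => h⟩) (fun a => (hT a).isCompact) hT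
    rw [mem_iInter] at hz
    exact ⟨⟨z, (hz ⟨_, hne.some_mem⟩).1⟩, fun a ha => (hz ⟨a, ha⟩).2⟩
  obtain ⟨⟨z, hzS⟩, hmax⟩ := exists_maximal_of_chains_bounded hchain
    fun h₁ h₂ => Between.trans h₁ h₂
  refine ⟨z, ?_⟩
  by_contra hne
  obtain ⟨α, hα⟩ := exists_arcMap_univ hX (Ne.symm hne)
  have hA : IsClosed (α '' Icc 0 (1 / 2)) := (isCompact_Icc.image hα.continuous).isClosed
  have hgA : g z ∉ α '' Icc 0 (1 / 2) := by
    rintro ⟨t, ht, htz⟩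
    have := hα.injOn ⟨ht.1, by linarith [ht.2]⟩ (by simp) (htz.trans hα.map_one.symm)
    linarith [ht.2]
  -- For small `t > 0`, g (α t) stays in V, hence beyond α t as seen from `p`. So α t also belongs
  -- to S and lies strictly after `z`, against maximality.
  obtain ⟨V, hVA, hV, hVc, hgV⟩ := exists_isOpen_isPreconnected hA.isOpen_compl hgA
  have hnhds : ∀ᶠ t in 𝓝 (0 : ℝ), g (α t) ∈ V :=
    (hg.comp hα.continuous).continuousAt.eventually_mem
      (hV.mem_nhds (by simpa [hα.map_zero] using hgV))
  obtain ⟨r, hr, hrV⟩ := Metric.eventually_nhds_iff.1 hnhds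
  obtain ⟨t, ht0, ht⟩ := exists_between (lt_min hr (show (0 : ℝ) < 1 / 2 by norm_num))
  obtain ⟨htr, ht2⟩ := lt_min_iff.1 ht
  have hgt : g (α t) ∈ V := hrV (by rwa [Real.dist_eq, sub_zero, abs_of_pos ht0])
  have h1 : Between p z (α t) := by
    intro C hC hp hw
    have hD : IsPreconnected (α '' Icc t 1) :=
      isPreconnected_Icc.image _ hα.continuous.continuousOn
    have htD : α t ∈ α '' Icc t 1 := mem_image_of_mem _ ⟨le_rfl, by linarith⟩
    rcases hzS _ (hC.union (α t) hw htD hD) (Or.inl hp)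
      (Or.inr ⟨1, ⟨by linarith, le_rfl⟩, hα.map_one⟩) with h | ⟨s, hs, hsz⟩
    · exact h
    · have := hα.injOn ⟨by linarith [hs.1], hs.2⟩ (by simp) (hsz.trans hα.map_zero.symm)
      linarith [hs.1]
  have h2 : Between p (α t) (g (α t)) := by
    intro C hC hp hw
    have hCV : IsPreconnected (C ∪ V) := hC.union _ hw hgt hVc
    have hz := hzS _ hCV (Or.inl hp) (Or.inr hgV)
    rcases hα.mem_of_isPreconnected hX hCV le_rfl ht0.le (by linarith : t ≤ 1) le_rfl
      (by rwa [hα.map_zero]) (by rw [hα.map_one]; exact Or.inr hgV) with h | h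
    · exact h
    · exact (hVA h ⟨t, ⟨ht0.le, ht2.le⟩, rfl⟩).elim
  have h3 := Between.antisymm hX (hmax ⟨α t, h2⟩ h1) h1
  have := hα.injOn ⟨ht0.le, by linarith⟩ (by simp) (h3.trans hα.map_zero.symm)
  exact ht0.ne' this

/-- A self-map of a dendrite moving `x` has a fixed point in the component of the complement of
`x` that contains the image of `x`. -/
theorem exists_fixedPoint_mem_component {X : Type*} [MetricSpace X] (hX : IsDendrite X)
    {g : X → X} (hg : Continuous g) {x : X} (hx : g x ≠ x) :
    ∃ w ∈ connectedComponentIn {x}ᶜ (g x), g w = w := by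
  classical
  have := hX.locallyConnected
  set D := connectedComponentIn {x}ᶜ (g x) with hD
  have hDo : IsOpen D := isOpen_compl_singleton.connectedComponentIn
  have hDx : ∀ y ∈ D, y ≠ x := fun y hy => connectedComponentIn_subset _ _ hy
  have hgD : g x ∈ D := mem_connectedComponentIn hx
  have hfr : ∀ y ∈ frontier D, y = x := by
    intro y hy
    rw [hDo.frontier_eq] at hy
    by_contra hne
    have hc : IsPreconnected (insert y D) :=
      isPreconnected_connectedComponentIn.subset_closure (subset_insert _ _)
        (insert_subset hy.1 subset_closure)
    have hsub : insert y D ⊆ {x}ᶜ := insert_subset hne (connectedComponentIn_subset _ _)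
    exact hy.2 (hc.subset_connectedComponentIn (mem_insert_of_mem _ hgD) hsub (mem_insert _ _))
  -- Collapse the complement of D to `x`. A fixed point of this map after `g` cannot be `x`, as g x
  -- ∈ D, so it is a fixed point of `g` in D.
  have hρ : Continuous fun y => if y ∈ D then y else x :=
    Continuous.if hfr continuous_id continuous_const
  obtain ⟨w, hw⟩ := exists_fixedPoint hX (hρ.comp hg)
  simp only [Function.comp] at hw
  split_ifs at hw with h
  · exact ⟨w, by rwa [hw] at h, hw⟩
  · rw [← hw] at h
    exact absurd hgD h

/-! ### Periodic points and expanding arcs -/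

theorem iterate_mem_periodicPts {X : Type*} {f : X → X} {x : X} (hx : x ∈ periodicPts f)
    (m : ℕ) : f^[m] x ∈ periodicPts f :=
  ((bijOn_periodicPts f).iterate m).mapsTo hx

/-! ### Connected periodic set: no expanding arcs -/

theorem exists_isPreconnected_notMem {X : Type*} [MetricSpace X] (hX : IsDendrite X) {f : X → X}
    (hf : Continuous f) (hP : IsPreconnected (periodicPts f)) {p x : X} (hp : p ∈ periodicPts f)
    (hx : x ∉ periodicPts f) {n : ℕ} (hn : 0 < n) :
    ∃ C : Set X, IsPreconnected C ∧ f^[n] x ∈ C ∧ p ∈ C ∧ x ∉ C := by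
  have hfx : f^[n] x ≠ x := fun h => hx (mk_mem_periodicPts hn h)
  obtain ⟨w, hwD, hw⟩ := exists_fixedPoint_mem_component hX (hf.iterate n) hfx
  refine ⟨connectedComponentIn {x}ᶜ (f^[n] x) ∪ periodicPts f,
    isPreconnected_connectedComponentIn.union w hwD (mk_mem_periodicPts hn hw) hP,
    Or.inl (mem_connectedComponentIn hfx), Or.inr hp, ?_⟩
  rintro (h | h)
  · exact connectedComponentIn_subset _ _ h rfl
  · exact hx h

/-- A non-periodic end `a` has a backward orbit under f^n inside the arc. Each later term sees `a`,
its own forward image, on the same side as Per(f). -/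
theorem ArcMap.left_mem_periodicPts {X : Type*} [MetricSpace X] (hX : IsDendrite X) {f : X → X}
    (hf : Continuous f) (hP : IsConnected (periodicPts f)) {α : ℝ → X} {a b : X}
    (hα : ArcMap α a b) {n : ℕ} (hn : 0 < n)
    (hsub : α '' Icc 0 1 ⊆ f^[n] '' (α '' Icc 0 1)) : a ∈ periodicPts f := by
  by_contra haP
  obtain ⟨p, hp⟩ := hP.nonempty
  have hback : ∀ t : Icc (0 : ℝ) 1, ∃ t' : Icc (0 : ℝ) 1, f^[n] (α t') = α t := by
    intro t
    obtain ⟨_, ⟨t', ht', rfl⟩, h⟩ := hsub ⟨t, t.2, rfl⟩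
    exact ⟨⟨t', ht'⟩, h⟩
  choose T hT using hback
  let τ : ℕ → Icc (0 : ℝ) 1 := fun k => T^[k] ⟨0, by simp⟩
  have hτ : ∀ k, f^[n] (α (τ (k + 1))) = α (τ k) := by
    intro k
    simp only [τ, iterate_succ_apply']
    exact hT _
  have hτa : ∀ k, f^[n * k] (α (τ k)) = a := by
    intro k
    induction k with
    | zero => simpa [τ] using hα.map_zero
    | succ k ih => rw [mul_add, mul_one, iterate_add_apply, hτ, ih]
  have hτP : ∀ k, α (τ k) ∉ periodicPts f := fun k h =>
    haP (hτa k ▸ iterate_mem_periodicPts h _)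
  have hsep : ∀ k, ∃ C : Set X, IsPreconnected C ∧ α 0 ∈ C ∧ p ∈ C ∧ α (τ (k + 1)) ∉ C := by
    intro k
    have := exists_isPreconnected_notMem hX hf hP.isPreconnected hp (hτP (k + 1))
      (Nat.mul_pos hn k.succ_pos)
    rwa [hτa, ← hα.map_zero] at this
  -- Otherwise α (τ (k + 1)) would lie between `a` and α (τ k), which are both on the `p` side of
  -- it.
  have hmono : StrictMono fun k => (τ k : ℝ) := by
    refine strictMono_nat_of_lt_succ fun k => ?_
    by_contra! hle
    obtain ⟨C₁, hC₁, h₁, hp₁, hx₁⟩ := hsep k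
    obtain ⟨C₂, hC₂, h₂, hp₂, hx₂⟩ := exists_isPreconnected_notMem hX hf hP.isPreconnected hp
      (hτP (k + 1)) hn
    rw [hτ] at h₂
    rcases hα.mem_of_isPreconnected hX (hC₁.union p hp₁ hp₂ hC₂) le_rfl (τ (k + 1)).2.1 hle
      (τ k).2.2 (Or.inl h₁) (Or.inr h₂) with h | h
    · exact hx₁ h
    · exact hx₂ h
  have hbdd : BddAbove (range fun k => (τ k : ℝ)) :=
    ⟨1, by rintro _ ⟨k, rfl⟩; exact (τ k).2.2⟩
  have hlim := tendsto_atTop_ciSup hmono.monotone hbdd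
  set t := ⨆ k, (τ k : ℝ)
  have hle : ∀ k, (τ k : ℝ) ≤ t := le_ciSup hbdd
  have ht1 : t ≤ 1 := ciSup_le fun k => (τ k).2.2
  have hαlim : Tendsto (fun k => α (τ k)) atTop (𝓝 (α t)) :=
    (hα.continuous.tendsto t).comp hlim
  have hfix : f^[n] (α t) = α t := by
    refine tendsto_nhds_unique ?_ hαlim
    have := ((hf.iterate n).tendsto (α t)).comp (hαlim.comp (tendsto_add_atTop_nat 1))
    refine this.congr fun k => ?_
    exact hτ k
  -- The first preimage lies between `a` and the periodic limit α t, yet C ∪ Per(f) joins these two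
  -- without it.
  obtain ⟨C, hC, h0, hpC, hx⟩ := hsep 0
  rcases hα.mem_of_isPreconnected hX (hC.union p hpC hp hP.isPreconnected) le_rfl (τ (0 + 1)).2.1
    (hle _) ht1 (Or.inl h0) (Or.inr (mk_mem_periodicPts hn hfix)) with h | h
  · exact hx h
  · exact hτP _ h

theorem ArcMap.reverse {X : Type*} [TopologicalSpace X] {α : ℝ → X} {a b : X}
    (hα : ArcMap α a b) : ArcMap (fun t => α (1 - t)) b a where
  continuous := hα.continuous.comp (by fun_prop)
  injOn := by
    intro s hs t ht h
    have := hα.injOn ⟨by linarith [hs.2], by linarith [hs.1]⟩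
      ⟨by linarith [ht.2], by linarith [ht.1]⟩ h
    linarith
  map_zero := by simpa using hα.map_one
  map_one := by simpa using hα.map_zero

theorem image_subset_image_iterate {X : Type*} {g : X → X} {A : Set X} (h : A ⊆ g '' A) (k : ℕ) :
    g '' A ⊆ g^[k + 1] '' A := by
  induction k with
  | zero => simp
  | succ k ih =>
    rw [iterate_succ, image_comp]
    exact ih.trans (image_mono h)

theorem not_isExpandingArc {X : Type*} [MetricSpace X] (hX : IsDendrite X) {f : X → X}
    (hf : Continuous f) (hP : IsConnected (periodicPts f)) (A : Set X) :
    ¬ IsExpandingArc f A := by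
  rintro ⟨hA, n, hn, hsub, hnot⟩
  obtain ⟨α, a, b, hα, rfl⟩ := exists_arcMap_of_isArc hA
  have ha := hα.left_mem_periodicPts hX hf hP hn hsub
  have hb : b ∈ periodicPts f := by
    refine hα.reverse.left_mem_periodicPts hX hf hP hn ?_
    have : (fun t => α (1 - t)) '' Icc 0 1 = α '' Icc 0 1 := by
      rw [← image_image α, image_const_sub_Icc]
      norm_num
    rwa [this]
  have hAP : ∀ t ∈ Icc (0 : ℝ) 1, α t ∈ periodicPts f := fun t ht =>
    hα.mem_of_isPreconnected hX hP.isPreconnected le_rfl ht.1 ht.2 le_rfl (by rwa [hα.map_zero])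
      (by rwa [hα.map_one])
  obtain ⟨i, hi, hai⟩ := ha
  obtain ⟨j, hj, hbj⟩ := hb
  set G := f^[n * (i * j)] with hG
  have hGa : G a = a := (hai.mul_const j).const_mul n
  have hGb : G b = b := (hbj.const_mul i).const_mul n
  have hGc : Continuous G := hf.iterate _
  have hGinj : InjOn G (periodicPts f) := ((bijOn_periodicPts f).iterate _).injOn
  have hbig : f^[n] '' (α '' Icc 0 1) ⊆ G '' (α '' Icc 0 1) := by
    obtain ⟨k, hk⟩ := Nat.exists_eq_succ_of_ne_zero (Nat.mul_pos hi hj).ne'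
    have := image_subset_image_iterate hsub k
    rwa [← iterate_mul, ← Nat.succ_eq_add_one, ← hk] at this
  obtain ⟨y, hy, hyA⟩ := not_subset.1 hnot
  obtain ⟨_, ⟨t, ht, rfl⟩, rfl⟩ := hbig hy
  have hclosed : ∀ u v, IsClosed (G '' (α '' Icc u v)) := fun u v =>
    ((isCompact_Icc.image hα.continuous).image hGc).isClosed
  have hconn : IsPreconnected (α '' Icc 0 1) :=
    isPreconnected_Icc.image _ hα.continuous.continuousOn
  have hcover : α '' Icc 0 1 ⊆ G '' (α '' Icc 0 t) ∪ G '' (α '' Icc t 1) := by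
    rw [← image_union, ← image_union, Icc_union_Icc_eq_Icc ht.1 ht.2]
    exact hsub.trans hbig
  -- The images of the two halves cover the connected arc, so they share a point of it. By
  -- injectivity of G on periodic points that point is G (α t), which lies outside the arc.
  obtain ⟨z, hzA, ⟨_, ⟨r, hr, rfl⟩, hrz⟩, ⟨_, ⟨s, hs, rfl⟩, hsz⟩⟩ :=
    isPreconnected_closed_iff.1 hconn _ _ (hclosed 0 t) (hclosed t 1) hcover
      ⟨a, ⟨0, by simp, hα.map_zero⟩, a, ⟨0, ⟨le_rfl, ht.1⟩, hα.map_zero⟩, hGa⟩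
      ⟨b, ⟨1, by simp, hα.map_one⟩, b, ⟨1, ⟨ht.2, le_rfl⟩, hα.map_one⟩, hGb⟩
  have hr1 : r ∈ Icc (0 : ℝ) 1 := ⟨hr.1, hr.2.trans ht.2⟩
  have hs1 : s ∈ Icc (0 : ℝ) 1 := ⟨ht.1.trans hs.1, hs.2⟩
  have hrs : r = s := hα.injOn hr1 hs1 (hGinj (hAP r hr1) (hAP s hs1) (hrz.trans hsz.symm))
  have hrt : r = t := le_antisymm hr.2 (hrs ▸ hs.1)
  rw [← hrz, hrt] at hzA
  exact hyA hzA

/-! ### No expanding arcs: connected periodic set -/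

theorem isPreconnected_periodicPts {X : Type*} [MetricSpace X] (hX : IsDendrite X) {f : X → X}
    (hf : Continuous f) (h : ¬ ∃ A : Set X, IsExpandingArc f A) :
    IsPreconnected (periodicPts f) := by
  refine isPreconnected_of_forall_pair fun x hx y hy => ?_
  by_cases hxy : x = y
  · subst hxy
    exact ⟨{x}, singleton_subset_iff.2 hx, rfl, rfl, isPreconnected_singleton⟩
  obtain ⟨α, hα⟩ := exists_arcMap_univ hX hxy
  obtain ⟨i, hi, hxi⟩ := hx
  obtain ⟨j, hj, hyj⟩ := hy
  have hn : 0 < i * j := Nat.mul_pos hi hj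
  set g := f^[i * j] with hg
  have hg0 : g (α 0) = α 0 := by rw [hα.map_zero]; exact hxi.mul_const j
  have hg1 : g (α 1) = α 1 := by rw [hα.map_one]; exact hyj.const_mul i
  have hgc : Continuous g := hf.iterate _
  have hconn : ∀ u v, IsPreconnected (g '' (α '' Icc u v)) := fun u v =>
    (isPreconnected_Icc.image _ hα.continuous.continuousOn).image _ hgc.continuousOn
  have hsub : g '' (α '' Icc 0 1) ⊆ α '' Icc 0 1 := by
    by_contra hnot
    refine h ⟨_, hα.isArc_image, _, hn, ?_, hnot⟩
    rintro _ ⟨t, ht, rfl⟩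
    exact hα.mem_of_isPreconnected hX (hconn 0 1) le_rfl ht.1 ht.2 le_rfl
      ⟨_, ⟨0, by simp, rfl⟩, hg0⟩ ⟨_, ⟨1, by simp, rfl⟩, hg1⟩
  refine ⟨α '' Icc 0 1, ?_, ⟨0, by simp, hα.map_zero⟩, ⟨1, by simp, hα.map_one⟩,
    isPreconnected_Icc.image _ hα.continuous.continuousOn⟩
  rintro _ ⟨t, ht, rfl⟩
  refine mk_mem_periodicPts hn ?_
  obtain ⟨s, hs, hst⟩ := hsub ⟨_, ⟨t, ht, rfl⟩, rfl⟩
  rcases lt_trichotomy s t with hlt | rfl | hlt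
  -- The image of α[t, 1] contains α s and α 1, hence α[s, 1], so α[t, 1] would be expanding; `t <
  -- 1` makes it a genuine arc. The case `t < s` is symmetric, with α[0, t].
  · have ht1 : t < 1 := ht.2.lt_of_ne fun h1 => by
      rw [h1, hg1] at hst
      have := hα.injOn hs (by simp) hst
      linarith
    refine (h ⟨_, hα.isArc_image_Icc ht.1 ht1 le_rfl, _, hn, ?_, fun hsup => ?_⟩).elim
    · rintro _ ⟨w, hw, rfl⟩
      exact hα.mem_of_isPreconnected hX (hconn t 1) hs.1 (hlt.le.trans hw.1) hw.2 le_rfl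
        ⟨_, ⟨t, ⟨le_rfl, ht.2⟩, rfl⟩, hst.symm⟩ ⟨_, ⟨1, ⟨ht.2, le_rfl⟩, rfl⟩, hg1⟩
    · obtain ⟨w, hw, hws⟩ := hsup ⟨_, ⟨t, ⟨le_rfl, ht.2⟩, rfl⟩, hst.symm⟩
      have := hα.injOn ⟨ht.1.trans hw.1, hw.2⟩ hs hws
      linarith [hw.1]
  · exact hst.symm
  · have ht0 : 0 < t := ht.1.lt_of_ne fun h0 => by
      rw [← h0, hg0] at hst
      have := hα.injOn hs (by simp) hst
      linarith
    refine (h ⟨_, hα.isArc_image_Icc le_rfl ht0 ht.2, _, hn, ?_, fun hsup => ?_⟩).elim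
    · rintro _ ⟨w, hw, rfl⟩
      exact hα.mem_of_isPreconnected hX (hconn 0 t) le_rfl hw.1 (hw.2.trans hlt.le) hs.2
        ⟨_, ⟨0, ⟨le_rfl, ht.1⟩, rfl⟩, hg0⟩ ⟨_, ⟨t, ⟨ht.1, le_rfl⟩, rfl⟩, hst.symm⟩
    · obtain ⟨w, hw, hws⟩ := hsup ⟨_, ⟨t, ⟨ht.1, le_rfl⟩, rfl⟩, hst.symm⟩
      have := hα.injOn ⟨hw.1, hw.2.trans ht.2⟩ hs hws
      linarith [hw.2]

end Dendrite

theorem mainTheorem5 {X : Type*} [MetricSpace X] (hX : IsDendrite X)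
    (f : X → X) (hf : Continuous f) :
    (¬ ∃ A : Set X, IsExpandingArc f A) ↔ IsConnected (Function.periodicPts f) := by
  refine ⟨fun h => ⟨?_, Dendrite.isPreconnected_periodicPts hX hf h⟩,
    fun hP ⟨A, hA⟩ => Dendrite.not_isExpandingArc hX hf hP A hA⟩
  obtain ⟨x, hx⟩ := Dendrite.exists_fixedPoint hX hf
  exact ⟨x, Function.mk_mem_periodicPts Nat.one_pos hx⟩
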